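/- Let $\mathcal A$ be the real algebra of nonabelian difference Laurent polynomials in the variables $u_n$, $n\in\mathbb Z$ (the group algebra over $\mathbb R$ of the free group on the $u_n$), with $u=u_0$ and shift automorphism $\mathcal S u_n=u_{n+1}$. Let $\mathcal F=\mathcal A/\big((\mathcal S-1)\mathcal A+[\mathcal A,\mathcal A]\big)$ be the space of local functionals, with projection $\int\mathrm{tr}\colon\mathcal A\to\mathcal F$. The variational derivative $\frac{\delta F}{\delta u}\in\mathcal A$ of $F=\int\mathrm{tr}\,f$ is defined by $\int\mathrm{tr}\,\frac{\delta F}{\delta u}v=\int\mathrm{tr}\,\frac{d}{d\epsilon}f(u+\epsilon v)\big|_{\epsilon=0}$ for all $v\in\mathcal A$. Write ${\rm l}_a f=af$, ${\rm r}_a f=fa$, ${\rm c}_a={\rm r}_a-{\rm l}_a$, and consider the nonlocal difference operator $$H={\rm r}_u\mathcal S{\rm r}_u-{\rm l}_u\mathcal S^{-1}{\rm l}_u+{\rm r}_u{\rm c}_u-{\rm c}_u(1-\mathcal S)^{-1}{\rm c}_u,$$ which is defined at those $a\in\mathcal A$ for which ${\rm c}_u a=(1-\mathcal S)q$ for some $q\in\mathcal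 A$, with $(1-\mathcal S)^{-1}{\rm c}_u a:=q$. **Proposition.** Every local functional has a unique variational derivative. The value $Ha$ does not depend on the choice of $q$, and $H$ is defined on all variational derivatives of local functionals. The operator $H$ is Hamiltonian: it is skewsymmetric, i.e. $\int\mathrm{tr}\,a(Hb)=-\int\mathrm{tr}\,(Ha)b$ for all $a,b$ in its domain, and $$\{F,G\}:=\int\mathrm{tr}\,\frac{\delta F}{\delta u}\,H\frac{\delta G}{\delta u}$$ is a well-defined Lie algebra bracket on $\mathcal F$, that is, it is bilinear and skewsymmetric and satisfies the Jacobi identity $\{A,\{B,C\}\}+\{B,\{C,A\}\}+\{C,\{A,B\}\}=0$ for all $A,B,C\in\mathcal F$. Moreover $H$ is the Hamiltonian structure of the nonabelian Volterra chain $u_t=u_1u-uu_{-1}$, with Hamiltonian $\int\mathrm{tr}\,u$, that is, $H\frac{\delta}{\delta u}\int\mathrm{tr}\,u=u_1u-uu_{-1}$. -/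

import Mathlib

noncomputable section

namespace NonabelianDifference

/-- The algebra `𝒜` of nonabelian difference Laurent polynomials over `ℝ` in the variables `u n`
(`n : ℤ`): the group algebra of the free group on the letters `u n`. -/
abbrev Alg : Type := MonoidAlgebra ℝ (FreeGroup ℤ)

/-- The generator `uₙ`. -/
def u (n : ℤ) : Alg := MonoidAlgebra.of ℝ (FreeGroup ℤ) (FreeGroup.of n)

/-- The inverse `uₙ⁻¹` of the generator `uₙ`. -/
def uInv (n : ℤ) : Alg := MonoidAlgebra.of ℝ (FreeGroup ℤ) (FreeGroup.of n)⁻¹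

theorem u_mul_uInv (n : ℤ) : u n * uInv n = 1 := by
  rw [u, uInv, ← map_mul, mul_inv_cancel, map_one]

theorem uInv_mul_u (n : ℤ) : uInv n * u n = 1 := by
  rw [u, uInv, ← map_mul, inv_mul_cancel, map_one]

/-- The power `𝒮ᵖ` of the shift automorphism, `𝒮ᵖ uₙ = uₙ₊ₚ`. -/
def shift (p : ℤ) : Alg →ₐ[ℝ] Alg :=
  MonoidAlgebra.mapDomainAlgHom ℝ ℝ (FreeGroup.map (fun n : ℤ => n + p))

/-- Left multiplication `l_a f = a f`. -/
def lmul (a : Alg) : Alg →ₗ[ℝ] Alg := LinearMap.mulLeft ℝ a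

/-- Right multiplication `r_a f = f a`. -/
def rmul (a : Alg) : Alg →ₗ[ℝ] Alg := LinearMap.mulRight ℝ a

/-- The commutator `c_a = r_a - l_a`. -/
def cmul (a : Alg) : Alg →ₗ[ℝ] Alg := rmul a - lmul a

/-- The subspace `(𝒮 - 1)𝒜 + [𝒜, 𝒜]`, where `[𝒜, 𝒜]` is the linear span of the commutators. -/
def nullDensities : Submodule ℝ Alg :=
  LinearMap.range ((shift 1).toLinearMap - LinearMap.id) ⊔
    Submodule.span ℝ {x : Alg | ∃ a b : Alg, x = a * b - b * a}

/-- The space `ℱ = 𝒜 / ((𝒮 - 1)𝒜 + [𝒜, 𝒜])` of local functionals. -/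
abbrev Functional : Type := Alg ⧸ nullDensities

/-- The projection `∫ tr : 𝒜 → ℱ`. -/
def intTr : Alg →ₗ[ℝ] Functional := nullDensities.mkQ

/-- The element `uₙ + ε 𝒮ⁿP` of `𝒜[ε]`, `ε² = 0`, as a unit, with inverse
`uₙ⁻¹ - ε uₙ⁻¹ (𝒮ⁿP) uₙ⁻¹`. -/
def perturbedGenerator (P : Alg) (n : ℤ) : (DualNumber Alg)ˣ where
  val := TrivSqZeroExt.inl (u n) + TrivSqZeroExt.inr (shift n P)
  inv := TrivSqZeroExt.inl (uInv n) - TrivSqZeroExt.inr (uInv n * shift n P * uInv n)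
  val_inv := by
    ext
    · simp [u_mul_uInv]
    · simp [← mul_assoc, u_mul_uInv]
  inv_val := by
    ext
    · simp [uInv_mul_u]
    · simp [mul_assoc, uInv_mul_u]

/-- The substitution `f ↦ f(u + ε P)`, where `ε` is a central shift-invariant parameter with
`ε² = 0`. -/
def perturb (P : Alg) : Alg →ₐ[ℝ] DualNumber Alg :=
  MonoidAlgebra.lift ℝ (DualNumber Alg) (FreeGroup ℤ)
    ((Units.coeHom (DualNumber Alg)).comp (FreeGroup.lift (perturbedGenerator P)))

/-- The Fréchet derivative `f_*[P]`, the coefficient of `ε` in `f(u + ε P)`. -/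
def frechet (f P : Alg) : Alg := (perturb P f).snd

/-- `a` is the variational derivative `δF/δu`: `∫ tr (a v) = ∫ tr f_*[v]` for all `v`, whatever
the density `f` of `F`. -/
def IsVariationalDerivative (F : Functional) (a : Alg) : Prop :=
  ∀ f : Alg, intTr f = F → ∀ v : Alg, intTr (a * v) = intTr (frechet f v)

/-- A possibly nonlocal (scalar) operator, given by its graph: `(a, b) ∈ H` means `b = H a`.
`H` is skewsymmetric if `∫ tr (a (H b)) = - ∫ tr ((H a) b)` on its domain. -/
def IsSkewsymmetric (H : Submodule ℝ (Alg × Alg)) : Prop :=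
  ∀ a Ha b Hb : Alg, (a, Ha) ∈ H → (b, Hb) ∈ H → intTr (a * Hb) = -intTr (Ha * b)

/-- `B` is a value of `{F, G} = ∫ tr (δF/δu · H (δG/δu))`. -/
def IsBracketValue (H : Submodule ℝ (Alg × Alg)) (F G B : Functional) : Prop :=
  ∃ f g h : Alg, IsVariationalDerivative F f ∧ IsVariationalDerivative G g ∧ (g, h) ∈ H ∧
    B = intTr (f * h)

/-- `H` is Hamiltonian: it is skewsymmetric, and the formula for `{F, G}` has exactly one value
for all local functionals `F`, `G` and defines a Lie algebra bracket on `ℱ`. -/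
def IsHamiltonian (H : Submodule ℝ (Alg × Alg)) : Prop :=
  IsSkewsymmetric H ∧
  ∃ br : Functional →ₗ[ℝ] Functional →ₗ[ℝ] Functional,
    (∀ F G B : Functional, IsBracketValue H F G B ↔ B = br F G) ∧
    (∀ F G : Functional, br F G = -br G F) ∧
    (∀ A B C : Functional, br A (br B C) + br B (br C A) + br C (br A B) = 0)

/-- The system `u_t = X` is Hamiltonian for the operator `H` and the Hamiltonian `h`:
`H` is Hamiltonian and `X = H (δh/δu)`. -/
def IsHamiltonianSystem (H : Submodule ℝ (Alg × Alg)) (h : Functional) (X : Alg) : Prop :=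
  IsHamiltonian H ∧ ∃ a : Alg, IsVariationalDerivative h a ∧ (a, X) ∈ H

/-- The local part `r_u 𝒮 r_u - l_u 𝒮⁻¹ l_u + r_u c_u`. -/
def volterraLocal : Alg →ₗ[ℝ] Alg :=
  rmul (u 0) ∘ₗ (shift 1).toLinearMap ∘ₗ rmul (u 0)
    - lmul (u 0) ∘ₗ (shift (-1)).toLinearMap ∘ₗ lmul (u 0)
    + rmul (u 0) ∘ₗ cmul (u 0)

/-- The operator `H = r_u 𝒮 r_u - l_u 𝒮⁻¹ l_u + r_u c_u - c_u (1 - 𝒮)⁻¹ c_u`, as a graph: it is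
defined at `a` when `c_u a = (1 - 𝒮) q` for some `q ∈ 𝒜`, and then `(1 - 𝒮)⁻¹ c_u a` is `q`. -/
def volterraOperator : Submodule ℝ (Alg × Alg) where
  carrier := {x | ∃ q : Alg, q - shift 1 q = cmul (u 0) x.1 ∧
    x.2 = volterraLocal x.1 - cmul (u 0) q}
  zero_mem' := ⟨0, by simp⟩
  add_mem' := by
    rintro x y ⟨q, hq, hx⟩ ⟨r, hr, hy⟩
    refine ⟨q + r, ?_, ?_⟩
    · rw [Prod.fst_add, map_add, map_add, ← hq, ← hr]; abel
    · rw [Prod.fst_add, Prod.snd_add, map_add, map_add, hx, hy]; abel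
  smul_mem' := by
    rintro c x ⟨q, hq, hx⟩
    refine ⟨c • q, ?_, ?_⟩
    · rw [Prod.smul_fst, map_smul, map_smul, ← hq, smul_sub]
    · rw [Prod.smul_fst, Prod.smul_snd, map_smul, map_smul, hx, smul_sub]

end NonabelianDifference

end

/-! If `a u - u a = q - 𝒮 q`, put `w = a u - q`. Then `a u = w + q`, `u a = w + 𝒮 q`, and the
nonlocal terms of `H` collapse to `H a = 𝒮 w u - u 𝒮⁻¹ w`. All later computations use only these two
relations, their linearisations along a vector field, cyclicity and shift invariance of the trace.

The domain: `exists_adjoint` shows that `c_u (δF/δu)` is a total difference. Uniqueness of `δF/δu`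
is nondegeneracy of the trace pairing (`eq_zero_of_intTr_mul_eq_zero`). `H` is single-valued because
shift-invariant elements are real constants, hence central.

The Jacobi identity: for `P = H a`, `Q = H b`, `R = H c` with `a`, `b`, `c` variational derivatives,
it reduces, by skewsymmetry and self-adjointness of the Fréchet derivative of `c`, to `∫ tr c
(Q_*[P] - P_*[Q]) = ∫ tr (a Q)_*[R]` (`intTr_mul_commutator`). Its algebraic core is
`IsShiftTrace.jacobi`. -/

namespace NonabelianDifference

/-! ### Identities for a shift-invariant trace on an arbitrary ring. -/

section ShiftTrace

variable {A F : Type*} [Ring A] [AddCommGroup F] (S : A ≃+* A) (T : A →+ F)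

/-- An additive map on a ring which vanishes on commutators and is invariant under `S`. -/
structure IsShiftTrace : Prop where
  comm : ∀ x y, T (x * y) = T (y * x)
  shift : ∀ x, T (S x) = T x

variable {S T}

namespace IsShiftTrace

theorem rotate (h : IsShiftTrace S T) (x y z : A) : T (x * (y * z)) = T (y * (z * x)) := by
  rw [h.comm, mul_assoc]

theorem rotate' (h : IsShiftTrace S T) (x y z : A) : T (x * (y * z)) = T (z * (x * y)) := by
  rw [← mul_assoc, h.comm]

theorem shift_mul (h : IsShiftTrace S T) (x y : A) : T (S x * S y) = T (x * y) := by
  rw [← map_mul, h.shift]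

theorem shift_mul_mul (h : IsShiftTrace S T) (x y z : A) :
    T (S x * (S y * S z)) = T (x * (y * z)) := by
  rw [← map_mul, ← map_mul, h.shift]

/-- The pairing of `c` with `S z * u - u * S⁻¹ z` in terms of `c * u = x + r`, `u * c = x + S r`. -/
theorem pairing (h : IsShiftTrace S T) {u c x r : A} (h₁ : c * u = x + r) (h₂ : u * c = x + S r)
    (z : A) : T (c * (S z * u - u * S.symm z)) =
      T (x * S z - x * S.symm z + (r - S r) * z) := by
  have e₁ : T (c * (S z * u)) = T ((x + S r) * S z) := by
    rw [h.rotate', ← mul_assoc, h₂]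
  have e₂ : T (c * (u * S.symm z)) = T ((x + r) * S.symm z) := by rw [← mul_assoc, h₁]
  have e₃ := h.shift_mul r z
  have e₄ : T (S r * z) = T (r * S.symm z) := by
    rw [← h.shift_mul r, S.apply_symm_apply]
  rw [mul_sub, map_sub, e₁, e₂]
  simp only [add_mul, sub_mul, map_add, map_sub, e₃, e₄]
  abel

/-- Symmetric bilinear relation between a covector `c` and the variation `y` of a covector `b`
along `P`. -/
theorem potential_pairing (h : IsShiftTrace S T) {u c x r b P y V Q : A}
    (h₁ : c * u = x + r) (h₂ : u * c = x + S r)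
    (h₃ : y * u + b * P = V + Q) (h₄ : u * y + P * b = V + S Q) :
    T ((r - S r) * V + x * (Q - S Q)) = T (P * (c * u * b - b * u * c)) := by
  obtain rfl : V = y * u + b * P - Q := by rw [h₃]; abel
  obtain rfl : x = u * c - S r := by rw [h₂]; abel
  have hr : r - S r = c * u - u * c := by rw [h₁]; abel
  have hQ : Q - S Q = y * u + b * P - (u * y + P * b) := by rw [h₄]; abel
  have e : (r - S r) * (y * u + b * P - Q) + (u * c - S r) * (Q - S Q) =
      (r - S r) * (y * u + b * P) + u * c * (Q - S Q) - (r * Q - S r * S Q) := by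
    noncomm_ring
  rw [e, hr, hQ]
  have e₁ := h.shift_mul r Q
  have e₂ := h.comm (c * u * y) u
  have e₃ := h.comm (c * u * b) P
  have e₄ := h.comm (u * c) (P * b)
  simp only [mul_add, mul_sub, sub_mul, map_add, map_sub, mul_assoc] at *
  rw [e₁, e₂, e₃, e₄]
  abel

theorem skew (h : IsShiftTrace S T) {u a w p b v q : A}
    (ha₁ : a * u = w + p) (ha₂ : u * a = w + S p)
    (hb₁ : b * u = v + q) (hb₂ : u * b = v + S q) :
    T (a * (S v * u - u * S.symm v)) = - T ((S w * u - u * S.symm w) * b) := by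
  -- With no variation the linearised relations become those of `b` itself, and the right-hand side
  -- vanishes.
  have e := h.potential_pairing (P := 0) ha₁ ha₂ (y := b) (b := 0) (V := v) (Q := q)
    (by simpa using hb₁) (by simpa using hb₂)
  have e₁ := h.shift_mul w (S.symm v)
  have e₂ := h.shift_mul (S.symm w) v
  rw [h.comm _ b, h.pairing ha₁ ha₂, h.pairing hb₁ hb₂]
  simp only [mul_sub, sub_mul, map_add, map_sub, zero_mul, map_zero, sub_zero,
    S.apply_symm_apply] at *
  rw [h.comm v (S w), h.comm v, h.comm q, h.comm (S q), e₁, ← e₂]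
  rw [← sub_eq_zero, ← e]
  abel

/-- The pairing of the variation `y` of a covector `b` along `R = S x * u - u * S⁻¹ x` with
`S w * u - u * S⁻¹ w`. -/
theorem variation_pairing (h : IsShiftTrace S T) {u b v q x w y V Q : A}
    (h₁ : b * u = v + q) (h₂ : u * b = v + S q)
    (h₃ : y * u + b * (S x * u - u * S.symm x) = V + Q)
    (h₄ : u * y + (S x * u - u * S.symm x) * b = V + S Q) :
    T (y * (S w * u - u * S.symm w)) =
      T (V * (S w - S.symm w) + (Q - S Q) * w - x * (S.symm v + q) * w
        - x * w * (S v + S q) + S x * u * S.symm w * b + S w * u * S.symm x * b) := by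
  have e₀ : T (y * (S w * u - u * S.symm w)) = T (u * y * S w - y * u * S.symm w) := by
    rw [mul_sub, map_sub, map_sub, h.rotate', mul_assoc, mul_assoc]
  -- Only `u y` and `y u` occur after cycling, and the linearised relations express both through `V`
  -- and `Q`.
  have hy₁ : u * y = V + S Q - S x * (u * b) + u * S.symm x * b := by
    rw [← sub_eq_zero, ← sub_eq_zero.2 h₄]; noncomm_ring
  have hy₂ : y * u = V + Q - b * S x * u + b * u * S.symm x := by
    rw [← sub_eq_zero, ← sub_eq_zero.2 h₃]; noncomm_ring
  rw [e₀, hy₁, hy₂, h₂, h₁]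
  have f₁ := h.shift_mul Q w
  have f₂ : T (S Q * w) = T (Q * S.symm w) := by
    rw [← h.shift_mul Q, S.apply_symm_apply]
  have f₃ := h.shift_mul_mul x (S.symm v) w
  have f₄ := h.shift_mul_mul x q w
  have f₅ := h.shift_mul_mul (S.symm x) (S.symm w) v
  have f₆ := h.shift_mul_mul (S.symm x) (S.symm w) q
  have f₇ := h.comm (u * S.symm x * b) (S w)
  have f₈ := h.comm b (S x * (u * S.symm w))
  have f₉ := h.rotate v (S.symm x) (S.symm w)
  have f₁₀ := h.rotate q (S.symm x) (S.symm w)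
  simp only [mul_add, add_mul, mul_sub, sub_mul, map_add, map_sub, mul_assoc,
    S.apply_symm_apply] at *
  rw [f₁, f₂, f₃, f₄, f₅, f₆, f₇, f₈, f₉, f₁₀]
  abel

/-- Self-adjointness `hy` allows the directions `x` and `w` to be exchanged. The terms `S x u S⁻¹w b
+ S w u S⁻¹x b` of `variation_pairing` are symmetric in them and cancel, so no explicit `u` or `b`
is left. -/
theorem variation_symm (h : IsShiftTrace S T) {u b v q x w y V Q y' V' Q' : A}
    (h₁ : b * u = v + q) (h₂ : u * b = v + S q)
    (h₃ : y * u + b * (S x * u - u * S.symm x) = V + Q)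
    (h₄ : u * y + (S x * u - u * S.symm x) * b = V + S Q)
    (h₃' : y' * u + b * (S w * u - u * S.symm w) = V' + Q')
    (h₄' : u * y' + (S w * u - u * S.symm w) * b = V' + S Q')
    (hy : T (y * (S w * u - u * S.symm w)) = T (y' * (S x * u - u * S.symm x))) :
    T (V * (S w - S.symm w) + (Q - S Q) * w) - T (V' * (S x - S.symm x) + (Q' - S Q') * x) =
      T ((x * w - w * x) * (S v + S q - S.symm v - q)) := by
  rw [h.variation_pairing h₁ h₂ h₃ h₄, h.variation_pairing h₁ h₂ h₃' h₄'] at hy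
  have f₁ := h.rotate' x (S.symm v) w
  have f₂ := h.rotate' x q w
  have f₃ := h.rotate' w (S.symm v) x
  have f₄ := h.rotate' w q x
  rw [← sub_eq_zero] at hy ⊢
  rw [← hy]
  simp only [mul_add, add_mul, mul_sub, sub_mul, map_add, map_sub, mul_assoc] at *
  rw [f₁, f₂, f₃, f₄]
  abel

/-- The term of the Jacobi identity in which no covector is varied. -/
theorem potential_cyclic (h : IsShiftTrace S T) {u b v q c x r : A} (w : A)
    (hb₁ : b * u = v + q) (hb₂ : u * b = v + S q)
    (hc₁ : c * u = x + r) (hc₂ : u * c = x + S r) :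
    T ((S w * u - u * S.symm w) * (c * u * b - b * u * c)) =
      T (S w * ((x + S r) * (v + S q) - (v + S q) * (x + S r))
        - S.symm w * ((x + r) * (v + q) - (v + q) * (x + r))) := by
  rw [← hb₁, ← hb₂, ← hc₁, ← hc₂]
  have f₁ := h.comm u (S.symm w * (c * (u * b)))
  have f₂ := h.comm u (S.symm w * (b * (u * c)))
  simp only [mul_sub, sub_mul, map_sub, mul_assoc] at *
  rw [f₁, f₂]
  abel

/-- Cycling a single `u` turns the word `a u b u c u` into `u a u b u c`. -/
theorem cubic (h : IsShiftTrace S T) {u a w p b v q c x r : A}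
    (ha₁ : a * u = w + p) (ha₂ : u * a = w + S p)
    (hb₁ : b * u = v + q) (hb₂ : u * b = v + S q)
    (hc₁ : c * u = x + r) (hc₂ : u * c = x + S r) :
    T ((w + p) * ((v + q) * (x + r) - (x + r) * (v + q))) =
      T ((w + S p) * ((v + S q) * (x + S r) - (x + S r) * (v + S q))) := by
  rw [← ha₁, ← hb₁, ← hc₁, ← ha₂, ← hb₂, ← hc₂]
  have f₁ := h.comm u (a * (u * (b * (u * c))))
  have f₂ := h.comm u (a * (u * (c * (u * b))))
  simp only [mul_sub, map_sub, mul_assoc] at *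
  rw [f₁, f₂]

/-- The suffixed letters stand for Fréchet derivatives: `aQ` for `a_*[Q]`, and so on.
`potential_pairing` trades `v`- and `w`-variations for `q`- and `p`-variations, `variation_symm`
trades variations along `P` and `Q` for variations along `R`, and `cubic` disposes of the remaining
derivative-free terms. -/
theorem jacobi (h : IsShiftTrace S T) {u a w p b v q c x r P Q R : A}
    {aQ wQ pQ aR wR pR bP vP qP bR vR qR : A}
    (ha₁ : a * u = w + p) (ha₂ : u * a = w + S p)
    (hb₁ : b * u = v + q) (hb₂ : u * b = v + S q)
    (hc₁ : c * u = x + r) (hc₂ : u * c = x + S r)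
    (hP : P = S w * u - u * S.symm w) (hQ : Q = S v * u - u * S.symm v)
    (hR : R = S x * u - u * S.symm x)
    (haQ₁ : aQ * u + a * Q = wQ + pQ) (haQ₂ : u * aQ + Q * a = wQ + S pQ)
    (haR₁ : aR * u + a * R = wR + pR) (haR₂ : u * aR + R * a = wR + S pR)
    (hbP₁ : bP * u + b * P = vP + qP) (hbP₂ : u * bP + P * b = vP + S qP)
    (hbR₁ : bR * u + b * R = vR + qR) (hbR₂ : u * bR + R * b = vR + S qR)
    (ha : T (aR * Q) = T (aQ * R)) (hb : T (bR * P) = T (bP * R)) :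
    T (c * (S (vP - wQ + (v * w - w * v)) * u - u * S.symm (vP - wQ + (v * w - w * v)))) =
      T (wR * (S v - S.symm v) + w * (S vR - S.symm vR) + (pR - S pR) * v + (p - S p) * vR) := by
  have m₁ := h.potential_pairing hc₁ hc₂ hbP₁ hbP₂
  have m₂ := h.potential_pairing hc₁ hc₂ haQ₁ haQ₂
  have m₃ := h.potential_pairing ha₁ ha₂ hbR₁ hbR₂
  rw [hP, h.potential_cyclic w hb₁ hb₂ hc₁ hc₂] at m₁
  rw [hQ, h.potential_cyclic v ha₁ ha₂ hc₁ hc₂] at m₂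
  rw [hR, h.potential_cyclic x hb₁ hb₂ ha₁ ha₂] at m₃
  subst hP hQ hR
  have s₁ := h.variation_symm ha₁ ha₂ haR₁ haR₂ haQ₁ haQ₂ ha
  have s₂ := h.variation_symm hb₁ hb₂ hbR₁ hbR₂ hbP₁ hbP₂ hb
  have t := h.cubic ha₁ ha₂ hb₁ hb₂ hc₁ hc₂
  rw [h.pairing hc₁ hc₂]
  rw [← sub_eq_zero] at m₁ m₂ m₃ s₁ s₂ t ⊢
  -- The following rules bring traces to a normal form modulo shift and cyclic permutation, so that
  -- the final identity is linear.
  have f₁ : ∀ y z, T (S y * z) = T (y * S.symm z) := fun y z => by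
    rw [← h.shift_mul y, S.apply_symm_apply]
  have f₂ : ∀ y z, T (S.symm y * z) = T (y * S z) := fun y z => by
    rw [← h.shift_mul _ z, S.apply_symm_apply]
  have g₁ := h.shift_mul_mul
  have g₂ : ∀ y z t, T (S y * (S z * t)) = T (y * (z * S.symm t)) := fun y z t => by
    rw [← g₁ y, S.apply_symm_apply]
  have g₃ : ∀ y z t, T (S y * (z * S t)) = T (y * (S.symm z * t)) := fun y z t => by
    rw [← g₁ y, S.apply_symm_apply]
  have g₄ : ∀ y z t, T (y * (S z * S t)) = T (S.symm y * (z * t)) := fun y z t => by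
    rw [← g₁ _ z, S.apply_symm_apply]
  have g₅ : ∀ y z t, T (y * (S.symm z * S.symm t)) = T (S y * (z * t)) := fun y z t => by
    rw [← g₁ y, S.apply_symm_apply, S.apply_symm_apply]
  have e₁ : ∀ z, T (z * x) = T (x * z) := fun z => h.comm z x
  have e₂ : ∀ z, T (z * w) = T (w * z) := fun z => h.comm z w
  have e₃ : ∀ z, T (z * S x) = T (x * S.symm z) := fun z => by rw [h.comm, f₁]
  have e₄ : ∀ z, T (z * S w) = T (w * S.symm z) := fun z => by rw [h.comm, f₁]
  have e₅ : ∀ z, T (z * S.symm x) = T (x * S z) := fun z => by rw [h.comm, f₂]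
  have e₆ : ∀ z, T (z * S.symm w) = T (w * S z) := fun z => by rw [h.comm, f₂]
  simp only [mul_add, add_mul, mul_sub, sub_mul, map_add, map_sub, map_mul,
    mul_assoc] at m₁ m₂ m₃ s₁ s₂ t ⊢
  rw [e₁ pQ, e₁ (S pQ), e₃ wQ, e₅ wQ] at s₁
  rw [e₁ qP, e₁ (S qP), e₃ vP, e₅ vP, e₂ qR, e₂ (S qR), e₄ vR, e₆ vR] at s₂
  simp only [g₁, g₂, g₃, g₄, g₅] at m₁ m₂ m₃ s₁ s₂ t ⊢
  -- Ordered rewriting selects one representative of each cyclic class of cubic words.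
  simp only [h.rotate, h.rotate'] at m₁ m₂ m₃ s₁ s₂ t ⊢
  linear_combination (norm := abel) s₂ - s₁ + m₁ - m₂ - m₃ - t

end IsShiftTrace
end ShiftTrace
end NonabelianDifference

noncomputable section
namespace NonabelianDifference

/-! ### The shift and the trace on the group algebra. -/

theorem algebra_induction {motive : Alg → Prop} (f : Alg) (one : motive 1)
    (gen : ∀ n, motive (u n)) (inv : ∀ n, motive (uInv n))
    (mul : ∀ f g, motive f → motive g → motive (f * g))
    (add : ∀ f g, motive f → motive g → motive (f + g))
    (smul : ∀ (r : ℝ) f, motive f → motive (r • f)) : motive f := by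
  refine MonoidAlgebra.induction_on f (fun g => ?_) add smul
  induction g using FreeGroup.induction_on with
  | C1 => rw [map_one]; exact one
  | of n => exact gen n
  | inv_of n _ => exact inv n
  | mul x y hx hy => rw [map_mul]; exact mul _ _ hx hy

@[simp] theorem shift_u (p n : ℤ) : shift p (u n) = u (n + p) := by
  simp [shift, u]

@[simp] theorem shift_uInv (p n : ℤ) : shift p (uInv n) = uInv (n + p) := by
  simp [shift, uInv]

@[simp] theorem shift_shift (p q : ℤ) (f : Alg) : shift p (shift q f) = shift (q + p) f := by
  induction f using algebra_induction with
  | one => simp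
  | gen n => simp [add_assoc]
  | inv n => simp [add_assoc]
  | mul f g hf hg => simp [hf, hg]
  | add f g hf hg => simp [hf, hg]
  | smul r f hf => simp [hf]

@[simp] theorem shift_zero (f : Alg) : shift 0 f = f := by
  induction f using algebra_induction with
  | one => simp
  | gen n => simp
  | inv n => simp
  | mul f g hf hg => simp [hf, hg]
  | add f g hf hg => simp [hf, hg]
  | smul r f hf => simp [hf]

/-- The shift `𝒮` as an automorphism. -/
def shiftEquiv : Alg ≃+* Alg where
  toFun := shift 1
  invFun := shift (-1)
  left_inv f := by simp
  right_inv f := by simp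
  map_mul' := map_mul _
  map_add' := map_add _

theorem shiftEquiv_apply (f : Alg) : shiftEquiv f = shift 1 f := rfl

theorem shiftEquiv_symm_apply (f : Alg) : shiftEquiv.symm f = shift (-1) f := rfl

theorem intTr_comm (f g : Alg) : intTr (f * g) = intTr (g * f) :=
  (Submodule.Quotient.eq _).2 (Submodule.mem_sup_right (Submodule.subset_span ⟨f, g, rfl⟩))

theorem intTr_shift_one (f : Alg) : intTr (shift 1 f) = intTr f :=
  (Submodule.Quotient.eq _).2 (Submodule.mem_sup_left ⟨f, rfl⟩)

theorem intTr_shift (p : ℤ) (f : Alg) : intTr (shift p f) = intTr f := by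
  induction p using Int.induction_on generalizing f with
  | zero => simp
  | succ n hn => rw [add_comm, ← shift_shift, hn, intTr_shift_one]
  | pred n hn => rw [← hn f, ← intTr_shift_one (shift (-n - 1) f)]; simp

/-- A linear map which vanishes on commutators and is shift-invariant factors through `∫ tr`. -/
theorem eq_of_intTr_eq {E : Type*} [AddCommGroup E] [Module ℝ E] (φ : Alg →ₗ[ℝ] E)
    (hcomm : ∀ f g, φ (f * g) = φ (g * f)) (hshift : ∀ f, φ (shift 1 f) = φ f)
    {f g : Alg} (h : intTr f = intTr g) : φ f = φ g := by
  have hle : nullDensities ≤ LinearMap.ker φ := by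
    refine sup_le ?_ (Submodule.span_le.2 ?_)
    · rintro _ ⟨f, rfl⟩
      simp [hshift]
    · rintro _ ⟨f, g, rfl⟩
      simp [hcomm f g]
  rw [← sub_eq_zero, ← map_sub]
  exact hle ((Submodule.Quotient.eq _).1 h)

/-- The coefficient of `1`. -/
def coeffOne : Alg →ₗ[ℝ] ℝ where
  toFun f := f.coeff 1
  map_add' f g := by simp
  map_smul' r f := by simp

theorem coeffOne_apply (f : Alg) : coeffOne f = f.coeff 1 := rfl

theorem coeffOne_of (g : FreeGroup ℤ) :
    coeffOne (MonoidAlgebra.of ℝ _ g) = if g = 1 then 1 else 0 := by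
  classical
  simp [coeffOne_apply, Finsupp.single_apply]

theorem coeffOne_comm (f g : Alg) : coeffOne (f * g) = coeffOne (g * f) := by
  induction f using MonoidAlgebra.induction_on with
  | of x =>
    induction g using MonoidAlgebra.induction_on with
    | of y =>
      rw [← map_mul, ← map_mul, coeffOne_of, coeffOne_of]
      simp only [mul_eq_one_comm (a := x)]
    | add f g hf hg => rw [mul_add, add_mul, map_add, map_add, hf, hg]
    | smul r f hf => rw [mul_smul_comm, smul_mul_assoc, map_smul, map_smul, hf]
  | add f g hf hg => simp [mul_add, add_mul, hf, hg]
  | smul r f hf => simp [hf]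

theorem coeffOne_shift (f : Alg) : coeffOne (shift 1 f) = coeffOne f := by
  induction f using MonoidAlgebra.induction_on with
  | of x =>
    have hinj : Function.Injective (FreeGroup.map fun n : ℤ => n + 1) :=
      FreeGroup.map_injective (add_left_injective 1)
    have : shift 1 (MonoidAlgebra.of ℝ _ x) =
        MonoidAlgebra.of ℝ _ (FreeGroup.map (fun n : ℤ => n + 1) x) := by simp [shift]
    rw [this, coeffOne_of, coeffOne_of]
    simp only [map_eq_one_iff _ hinj]
  | add f g hf hg => simp [hf, hg]
  | smul r f hf => simp [hf]

/-- The coefficient of `g` in `a` is the coefficient of `1` in `a g⁻¹`, and the latter depends only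
on `∫ tr (a g⁻¹)`. -/
theorem eq_zero_of_intTr_mul_eq_zero {a : Alg} (h : ∀ v, intTr (a * v) = 0) : a = 0 := by
  ext g
  have h₁ := eq_of_intTr_eq coeffOne coeffOne_comm coeffOne_shift
    ((h (MonoidAlgebra.of ℝ _ g⁻¹)).trans (map_zero intTr).symm)
  simpa [coeffOne_apply] using h₁

/-! ### Fréchet derivatives and evolutionary derivations. -/

@[simp] theorem perturb_u (P : Alg) (n : ℤ) :
    perturb P (u n) = TrivSqZeroExt.inl (u n) + TrivSqZeroExt.inr (shift n P) := by
  simp [perturb, u, perturbedGenerator]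

@[simp] theorem perturb_uInv (P : Alg) (n : ℤ) : perturb P (uInv n) =
    TrivSqZeroExt.inl (uInv n) - TrivSqZeroExt.inr (uInv n * shift n P * uInv n) := by
  rw [perturb, uInv, MonoidAlgebra.lift_of, MonoidHom.comp_apply, map_inv, FreeGroup.lift_apply_of]
  rfl

@[simp] theorem fst_perturb (P f : Alg) : (perturb P f).fst = f := by
  induction f using algebra_induction with
  | one => simp
  | gen n => simp
  | inv n => simp
  | mul f g hf hg => simp [hf, hg]
  | add f g hf hg => simp [hf, hg]
  | smul r f hf => simp [hf]

@[simp] theorem frechet_one (P : Alg) : frechet 1 P = 0 := by simp [frechet]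

@[simp] theorem frechet_u (n : ℤ) (P : Alg) : frechet (u n) P = shift n P := by simp [frechet]

@[simp] theorem frechet_uInv (n : ℤ) (P : Alg) :
    frechet (uInv n) P = -(uInv n * shift n P * uInv n) := by simp [frechet]

@[simp] theorem frechet_mul (f g P : Alg) :
    frechet (f * g) P = f * frechet g P + frechet f P * g := by simp [frechet]

@[simp] theorem frechet_add (f g P : Alg) : frechet (f + g) P = frechet f P + frechet g P := by
  simp [frechet]

@[simp] theorem frechet_sub (f g P : Alg) : frechet (f - g) P = frechet f P - frechet g P := by
  simp [frechet]

@[simp] theorem frechet_smul (r : ℝ) (f P : Alg) : frechet (r • f) P = r • frechet f P := by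
  simp [frechet]

theorem frechet_shift (p : ℤ) (f P : Alg) : frechet (shift p f) P = shift p (frechet f P) := by
  induction f using algebra_induction with
  | one => simp
  | gen n => simp
  | inv n => simp
  | mul f g hf hg => simp [hf, hg]
  | add f g hf hg => simp [hf, hg]
  | smul r f hf => simp [hf]

@[simp] theorem frechet_neg (f P : Alg) : frechet (-f) P = -frechet f P := by simp [frechet]

/-- Evolutionary derivations form a Lie algebra. -/
theorem frechet_frechet_sub (f P Q : Alg) :
    frechet (frechet f Q) P - frechet (frechet f P) Q =
      frechet f (frechet Q P - frechet P Q) := by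
  induction f using algebra_induction with
  | one => simp [frechet]
  | gen n => simp [frechet_shift]
  | inv n =>
    simp only [frechet_uInv, frechet_neg, frechet_mul, frechet_shift, map_sub]
    noncomm_ring
  | mul f g hf hg => simp only [frechet_mul, frechet_add, ← hf, ← hg]; noncomm_ring
  | add f g hf hg => simp only [frechet_add, ← hf, ← hg]; abel
  | smul r f hf => simp only [frechet_smul, ← hf, smul_sub]

/-- The evolutionary derivation `f ↦ f_*[P]`. -/
def evolution (P : Alg) : Alg →ₗ[ℝ] Alg where
  toFun f := frechet f P
  map_add' f g := frechet_add f g P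
  map_smul' r f := frechet_smul r f P

theorem intTr_frechet_congr {f g : Alg} (h : intTr f = intTr g) (P : Alg) :
    intTr (frechet f P) = intTr (frechet g P) := by
  refine eq_of_intTr_eq (intTr ∘ₗ evolution P) (fun f g => ?_) (fun f => ?_) h
  · change intTr (frechet (f * g) P) = intTr (frechet (g * f) P)
    rw [frechet_mul, frechet_mul, map_add, map_add, intTr_comm f, intTr_comm _ g, add_comm]
  · change intTr (frechet (shift 1 f) P) = intTr (frechet f P)
    rw [frechet_shift, intTr_shift]

/-! ### Variational derivatives. -/

theorem isVariationalDerivative_iff {f a : Alg} :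
    IsVariationalDerivative (intTr f) a ↔ ∀ v, intTr (a * v) = intTr (frechet f v) :=
  ⟨fun h => h f rfl, fun h _ hg v => (h v).trans (intTr_frechet_congr hg v).symm⟩

theorem intTr_surjective : Function.Surjective intTr := nullDensities.mkQ_surjective

theorem IsVariationalDerivative.unique {F : Functional} {a b : Alg}
    (ha : IsVariationalDerivative F a) (hb : IsVariationalDerivative F b) : a = b := by
  obtain ⟨f, rfl⟩ := intTr_surjective F
  refine sub_eq_zero.1 (eq_zero_of_intTr_mul_eq_zero fun v => ?_)
  rw [sub_mul, map_sub, ha f rfl, hb f rfl, sub_self]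

theorem shift_sub_self_mem_range (p : ℤ) (f : Alg) : ∃ q, q - shift 1 q = f - shift p f := by
  induction p using Int.induction_on with
  | zero => exact ⟨0, by simp⟩
  | succ n hn =>
    obtain ⟨q, hq⟩ := hn
    refine ⟨q + shift n f, ?_⟩
    rw [map_add, shift_shift, add_sub_add_comm, hq]; abel
  | pred n hn =>
    obtain ⟨q, hq⟩ := hn
    refine ⟨q - shift (-n - 1) f, ?_⟩
    rw [map_sub, shift_shift, sub_sub_sub_comm, hq, sub_add_cancel]; abel

/-- The adjoint of `v ↦ x f_*[v]` applied to `1`, together with the fact that its commutator with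
`u` is `x f - f x` up to a total difference. -/
theorem exists_adjoint (f x : Alg) : ∃ a q : Alg,
    (∀ v, intTr (a * v) = intTr (x * frechet f v)) ∧
      q - shift 1 q = a * u 0 - u 0 * a - (x * f - f * x) := by
  -- The weight `x` must be free because the product rule changes it; only `x = 1`, where `x f - f
  -- x` vanishes, is used in the end.
  induction f using algebra_induction generalizing x with
  | one => exact ⟨0, 0, by simp⟩
  | gen n =>
    obtain ⟨q, hq⟩ := shift_sub_self_mem_range n (shift (-n) (x * u n - u n * x))
    refine ⟨shift (-n) x, q, fun v => ?_, ?_⟩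
    · rw [frechet_u, ← intTr_shift n]; simp
    · rw [hq]; simp
  | inv n =>
    obtain ⟨q, hq⟩ := shift_sub_self_mem_range n (shift (-n) (x * uInv n - uInv n * x))
    refine ⟨-shift (-n) (uInv n * x * uInv n), q, fun v => ?_, ?_⟩
    · rw [frechet_uInv, neg_mul, mul_neg, map_neg, map_neg, ← intTr_shift n,
        ← mul_assoc, intTr_comm _ (uInv n)]
      simp [mul_assoc]
    · rw [hq]
      have h : u 0 = shift (-n) (u n) := by simp
      simp [mul_assoc, uInv_mul_u, ← mul_assoc (u 0), u_mul_uInv]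
      abel
  | mul f g hf hg =>
    -- Under the trace `x (f g)_*` is `(g x) f_* + (x f) g_*`, and the commutators telescope: `[g x,
    -- f] + [x f, g] = [x, f g]`.
    obtain ⟨a, p, ha, hp⟩ := hf (g * x)
    obtain ⟨b, q, hb, hq⟩ := hg (x * f)
    refine ⟨a + b, p + q, fun v => ?_, ?_⟩
    · rw [add_mul, map_add, ha, hb, frechet_mul, mul_add, map_add, mul_assoc g,
        intTr_comm g, add_comm, mul_assoc, mul_assoc]
    · rw [map_add, add_sub_add_comm, hp, hq]; noncomm_ring
  | add f g hf hg =>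
    obtain ⟨a, p, ha, hp⟩ := hf x
    obtain ⟨b, q, hb, hq⟩ := hg x
    refine ⟨a + b, p + q, fun v => ?_, ?_⟩
    · rw [add_mul, map_add, ha, hb, frechet_add, mul_add, map_add]
    · rw [map_add, add_sub_add_comm, hp, hq]; noncomm_ring
  | smul r f hf =>
    obtain ⟨a, p, ha, hp⟩ := hf x
    refine ⟨r • a, r • p, fun v => ?_, ?_⟩
    · simp [ha]
    · rw [map_smul, ← smul_sub, hp]; simp [smul_sub]

theorem exists_variationalDerivative (f : Alg) : ∃ a q : Alg,
    IsVariationalDerivative (intTr f) a ∧ q - shift 1 q = cmul (u 0) a := by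
  obtain ⟨a, q, ha, hq⟩ := exists_adjoint f 1
  refine ⟨a, q, isVariationalDerivative_iff.2 (by simpa using ha), ?_⟩
  simpa [cmul, rmul, lmul] using hq

/-! ### Shift-invariant elements are constants. -/

/-- The retraction onto the subalgebra generated by the `u n` with `0 ≤ n`. -/
def retraction : Alg →ₐ[ℝ] Alg :=
  MonoidAlgebra.mapDomainAlgHom ℝ ℝ
    (FreeGroup.lift fun n : ℤ => if 0 ≤ n then FreeGroup.of n else 1)

theorem retraction_u (n : ℤ) : retraction (u n) = if 0 ≤ n then u n else 1 := by
  split_ifs with h <;> simp [retraction, u, h, MonoidAlgebra.one_def]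

theorem retraction_uInv (n : ℤ) : retraction (uInv n) = if 0 ≤ n then uInv n else 1 := by
  split_ifs with h <;> simp [retraction, uInv, h, MonoidAlgebra.one_def]

/-- Only finitely many letters occur in `f`: far to the right all indices are nonnegative, far to
the left all are negative and every letter is sent to `1`. -/
theorem exists_retraction_shift (f : Alg) : ∃ N : ℤ, ∀ M ≥ N,
    retraction (shift M f) = shift M f ∧ ∃ c : ℝ, retraction (shift (-M) f) = c • 1 := by
  induction f using algebra_induction with
  | one => exact ⟨0, fun M _ => ⟨by simp, 1, by simp⟩⟩
  | gen n =>
    refine ⟨|n| + 1, fun M hM => ⟨?_, 1, ?_⟩⟩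
    · rw [shift_u, retraction_u, if_pos (by grind)]
    · rw [shift_u, retraction_u, if_neg (by grind), one_smul]
  | inv n =>
    refine ⟨|n| + 1, fun M hM => ⟨?_, 1, ?_⟩⟩
    · rw [shift_uInv, retraction_uInv, if_pos (by grind)]
    · rw [shift_uInv, retraction_uInv, if_neg (by grind), one_smul]
  | mul f g hf hg =>
    obtain ⟨N, hN⟩ := hf
    obtain ⟨K, hK⟩ := hg
    refine ⟨max N K, fun M hM => ?_⟩
    obtain ⟨h₁, c, hc⟩ := hN M (le_trans (le_max_left _ _) hM)
    obtain ⟨h₂, d, hd⟩ := hK M (le_trans (le_max_right _ _) hM)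
    exact ⟨by simp [h₁, h₂], c * d, by simp [hc, hd, smul_smul, mul_comm]⟩
  | add f g hf hg =>
    obtain ⟨N, hN⟩ := hf
    obtain ⟨K, hK⟩ := hg
    refine ⟨max N K, fun M hM => ?_⟩
    obtain ⟨h₁, c, hc⟩ := hN M (le_trans (le_max_left _ _) hM)
    obtain ⟨h₂, d, hd⟩ := hK M (le_trans (le_max_right _ _) hM)
    exact ⟨by simp [h₁, h₂], c + d, by simp [hc, hd, add_smul]⟩
  | smul r f hf =>
    obtain ⟨N, hN⟩ := hf
    refine ⟨N, fun M hM => ?_⟩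
    obtain ⟨h₁, c, hc⟩ := hN M hM
    exact ⟨by simp [h₁], r * c, by simp [hc, smul_smul]⟩

theorem shift_eq_self_of_shift_one {f : Alg} (h : shift 1 f = f) (p : ℤ) : shift p f = f := by
  induction p using Int.induction_on with
  | zero => simp
  | succ n hn => rw [add_comm, ← shift_shift, h, hn]
  | pred n hn => rw [← h, shift_shift, add_comm 1, sub_add_cancel, hn, h]

/-- An invariant `f` equals both of its far shifts, so its retraction is at once `f` and a constant.
-/
theorem eq_smul_one_of_shift_eq_self {f : Alg} (h : shift 1 f = f) : ∃ c : ℝ, f = c • 1 := by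
  obtain ⟨N, hN⟩ := exists_retraction_shift f
  obtain ⟨h₁, c, hc⟩ := hN N le_rfl
  simp only [shift_eq_self_of_shift_one h] at h₁ hc
  exact ⟨c, h₁.symm.trans hc⟩

/-! ### The operator `H`: normal form, single-valuedness, skewsymmetry, domain. -/

theorem isShiftTrace_intTr : IsShiftTrace shiftEquiv intTr.toAddMonoidHom :=
  ⟨intTr_comm, intTr_shift_one⟩

/-- `H a = 𝒮 w u - u 𝒮⁻¹ w`, where `a u = w + q`, `u a = w + 𝒮 q`. -/
theorem mem_volterraOperator_iff {a b : Alg} : (a, b) ∈ volterraOperator ↔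
    ∃ w q : Alg, a * u 0 = w + q ∧ u 0 * a = w + shiftEquiv q ∧
      b = shiftEquiv w * u 0 - u 0 * shiftEquiv.symm w := by
  have hval (w q : Alg) (h₁ : a * u 0 = w + q) (h₂ : u 0 * a = w + shiftEquiv q) :
      volterraLocal a - cmul (u 0) q = shiftEquiv w * u 0 - u 0 * shiftEquiv.symm w := by
    have e : volterraLocal a - cmul (u 0) q = shiftEquiv (a * u 0) * u 0
        - u 0 * shiftEquiv.symm (u 0 * a) + (a * u 0 - u 0 * a) * u 0
        - (q * u 0 - u 0 * q) := rfl
    rw [e, h₁, h₂, map_add, map_add, shiftEquiv.symm_apply_apply]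
    noncomm_ring
  constructor
  · rintro ⟨q, hq, hb⟩
    have hq' : q - shiftEquiv q = a * u 0 - u 0 * a := hq
    have h₂ : u 0 * a = a * u 0 - q + shiftEquiv q := by
      rw [← sub_eq_zero, ← sub_eq_zero.2 hq']; abel
    exact ⟨a * u 0 - q, q, by abel, h₂, hb.trans (hval _ _ (by abel) h₂)⟩
  · rintro ⟨w, q, h₁, h₂, rfl⟩
    refine ⟨q, ?_, (hval w q h₁ h₂).symm⟩
    change q - shiftEquiv q = a * u 0 - u 0 * a
    rw [h₁, h₂]; abel

/-- Two choices of `q` differ by a shift-invariant element, hence by a constant, which `c_u` kills.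
-/
theorem volterraOperator_unique {a b b' : Alg} (h : (a, b) ∈ volterraOperator)
    (h' : (a, b') ∈ volterraOperator) : b = b' := by
  obtain ⟨q, hq, hb⟩ := h
  obtain ⟨q', hq', hb'⟩ := h'
  obtain ⟨c, hc⟩ := eq_smul_one_of_shift_eq_self (f := q - q') (by
    rw [map_sub, eq_comm, ← sub_eq_zero, ← sub_eq_zero.2 (hq.trans hq'.symm)]; abel)
  have h : cmul (u 0) q = cmul (u 0) q' := by
    rw [← sub_eq_zero, ← map_sub, hc]
    simp [cmul, rmul, lmul]
  exact hb.trans (by rw [h]; exact hb'.symm)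

theorem isSkewsymmetric_volterraOperator : IsSkewsymmetric volterraOperator := by
  intro a P b Q ha hb
  obtain ⟨w, p, ha₁, ha₂, rfl⟩ := mem_volterraOperator_iff.1 ha
  obtain ⟨v, q, hb₁, hb₂, rfl⟩ := mem_volterraOperator_iff.1 hb
  exact isShiftTrace_intTr.skew ha₁ ha₂ hb₁ hb₂

theorem existsUnique_variationalDerivative (F : Functional) :
    ∃! a, IsVariationalDerivative F a := by
  obtain ⟨f, rfl⟩ := intTr_surjective F
  obtain ⟨a, -, ha, -⟩ := exists_variationalDerivative f
  exact ⟨a, ha, fun b hb => hb.unique ha⟩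

theorem exists_mem_volterraOperator {F : Functional} {a : Alg}
    (ha : IsVariationalDerivative F a) : ∃ b, (a, b) ∈ volterraOperator := by
  obtain ⟨f, rfl⟩ := intTr_surjective F
  obtain ⟨a', q, ha', hq⟩ := exists_variationalDerivative f
  obtain rfl := ha.unique ha'
  exact ⟨volterraLocal a - cmul (u 0) q, q, hq, rfl⟩

/-! ### The bracket as a bilinear map. -/

theorem IsVariationalDerivative.add {F G : Functional} {a b : Alg}
    (ha : IsVariationalDerivative F a) (hb : IsVariationalDerivative G b) :
    IsVariationalDerivative (F + G) (a + b) := by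
  obtain ⟨f, rfl⟩ := intTr_surjective F
  obtain ⟨g, rfl⟩ := intTr_surjective G
  rw [← map_add, isVariationalDerivative_iff]
  intro v
  rw [add_mul, map_add, ha f rfl, hb g rfl, frechet_add, map_add]

theorem IsVariationalDerivative.smul {F : Functional} {a : Alg}
    (ha : IsVariationalDerivative F a) (r : ℝ) : IsVariationalDerivative (r • F) (r • a) := by
  obtain ⟨f, rfl⟩ := intTr_surjective F
  rw [← map_smul, isVariationalDerivative_iff]
  intro v
  rw [smul_mul_assoc, map_smul, ha f rfl, frechet_smul, map_smul]

/-- The variational derivative `δ/δu : ℱ → 𝒜`. -/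
def variationalDerivative : Functional →ₗ[ℝ] Alg where
  toFun F := (existsUnique_variationalDerivative F).choose
  map_add' F G := (existsUnique_variationalDerivative _).choose_spec.1.unique
    ((existsUnique_variationalDerivative F).choose_spec.1.add
      (existsUnique_variationalDerivative G).choose_spec.1)
  map_smul' r F := (existsUnique_variationalDerivative _).choose_spec.1.unique
    ((existsUnique_variationalDerivative F).choose_spec.1.smul r)

theorem variationalDerivative_spec (F : Functional) :
    IsVariationalDerivative F (variationalDerivative F) :=
  (existsUnique_variationalDerivative F).choose_spec.1

/-- The value `H (δF/δu)`. -/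
def hamiltonianValue (F : Functional) : Alg :=
  (exists_mem_volterraOperator (variationalDerivative_spec F)).choose

theorem hamiltonianValue_spec (F : Functional) :
    (variationalDerivative F, hamiltonianValue F) ∈ volterraOperator :=
  (exists_mem_volterraOperator (variationalDerivative_spec F)).choose_spec

/-- The Hamiltonian vector field `F ↦ H (δF/δu)`. -/
def hamiltonianField : Functional →ₗ[ℝ] Alg where
  toFun := hamiltonianValue
  map_add' F G := by
    refine volterraOperator_unique (hamiltonianValue_spec (F + G)) ?_
    rw [map_add, ← Prod.mk_add_mk]
    exact volterraOperator.add_mem (hamiltonianValue_spec F) (hamiltonianValue_spec G)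
  map_smul' r F := by
    refine volterraOperator_unique (hamiltonianValue_spec (r • F)) ?_
    rw [map_smul, RingHom.id_apply, ← Prod.smul_mk]
    exact volterraOperator.smul_mem r (hamiltonianValue_spec F)

theorem hamiltonianField_spec (F : Functional) :
    (variationalDerivative F, hamiltonianField F) ∈ volterraOperator :=
  hamiltonianValue_spec F

/-- The bracket `{F, G} = ∫ tr (δF/δu · H (δG/δu))`. -/
def bracket : Functional →ₗ[ℝ] Functional →ₗ[ℝ] Functional :=
  ((LinearMap.mul ℝ Alg).compl₁₂ variationalDerivative hamiltonianField).compr₂ intTr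

theorem bracket_apply (F G : Functional) :
    bracket F G = intTr (variationalDerivative F * hamiltonianField G) := rfl

theorem isBracketValue_iff (F G B : Functional) :
    IsBracketValue volterraOperator F G B ↔ B = bracket F G := by
  constructor
  · rintro ⟨f, g, h, hf, hg, hgh, rfl⟩
    obtain rfl := hf.unique (variationalDerivative_spec F)
    obtain rfl := hg.unique (variationalDerivative_spec G)
    rw [volterraOperator_unique hgh (hamiltonianField_spec G), bracket_apply]
  · rintro rfl
    exact ⟨_, _, _, variationalDerivative_spec F, variationalDerivative_spec G,
      hamiltonianField_spec G, rfl⟩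

theorem bracket_skew (F G : Functional) : bracket F G = -bracket G F := by
  rw [bracket_apply, bracket_apply, isSkewsymmetric_volterraOperator _ _ _ _
    (hamiltonianField_spec F) (hamiltonianField_spec G), intTr_comm]

/-! ### The Jacobi identity. -/

/-- The Fréchet derivative of a variational derivative is symmetric. -/
theorem IsVariationalDerivative.frechet_symm {F : Functional} {a : Alg}
    (ha : IsVariationalDerivative F a) (P Q : Alg) :
    intTr (frechet a P * Q) = intTr (frechet a Q * P) := by
  obtain ⟨f, rfl⟩ := intTr_surjective F
  have h (P Q : Alg) : intTr (a * frechet Q P) + intTr (frechet a P * Q) =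
      intTr (frechet (frechet f Q) P) := by
    rw [← map_add, ← frechet_mul, intTr_frechet_congr (ha f rfl Q)]
  -- The two orders of the second variation differ by `f_*` along the commutator of the fields,
  -- which equals the difference of the terms `a Q_*[P]` and `a P_*[Q]` under the trace.
  have hc := congrArg intTr (frechet_frechet_sub f P Q)
  rw [map_sub, ← h, ← h, ← ha f rfl, mul_sub, map_sub] at hc
  rw [← sub_eq_zero, ← sub_eq_zero.2 hc]
  abel

theorem shiftEquiv_frechet (f P : Alg) :
    frechet (shiftEquiv f) P = shiftEquiv (frechet f P) := frechet_shift 1 f P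

theorem shiftEquiv_symm_frechet (f P : Alg) :
    frechet (shiftEquiv.symm f) P = shiftEquiv.symm (frechet f P) := frechet_shift (-1) f P

/-- The commutator of two Hamiltonian vector fields, paired with a variational derivative. -/
theorem intTr_mul_commutator {F G : Functional} {a b c P Q R : Alg}
    (ha : IsVariationalDerivative F a) (hb : IsVariationalDerivative G b)
    (haP : (a, P) ∈ volterraOperator) (hbQ : (b, Q) ∈ volterraOperator)
    (hcR : (c, R) ∈ volterraOperator) :
    intTr (c * (frechet Q P - frechet P Q)) = intTr (frechet (a * Q) R) := by
  obtain ⟨w, p, ha₁, ha₂, hP⟩ := mem_volterraOperator_iff.1 haP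
  obtain ⟨v, q, hb₁, hb₂, hQ⟩ := mem_volterraOperator_iff.1 hbQ
  obtain ⟨x, r, hc₁, hc₂, hR⟩ := mem_volterraOperator_iff.1 hcR
  have right {a w p : Alg} (h : a * u 0 = w + p) (X : Alg) :
      frechet a X * u 0 + a * X = frechet w X + frechet p X := by
    rw [← frechet_add, ← h]; simp [add_comm]
  have left {a w p : Alg} (h : u 0 * a = w + shiftEquiv p) (X : Alg) :
      u 0 * frechet a X + X * a = frechet w X + shiftEquiv (frechet p X) := by
    rw [← shiftEquiv_frechet, ← frechet_add, ← h]; simp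
  have key := isShiftTrace_intTr.jacobi ha₁ ha₂ hb₁ hb₂ hc₁ hc₂ hP hQ hR
    (right ha₁ Q) (left ha₂ Q) (right ha₁ R) (left ha₂ R) (right hb₁ P) (left hb₂ P)
    (right hb₁ R) (left hb₂ R) (ha.frechet_symm R Q) (hb.frechet_symm R P)
  -- The commutator again has the form `𝒮 z u - u 𝒮⁻¹ z`: the mixed terms `𝒮 v u 𝒮⁻¹ w` and `𝒮 w u
  -- 𝒮⁻¹ v` cancel, and the others give `[v, w]`.
  have hz : frechet Q P - frechet P Q =
      shiftEquiv (frechet v P - frechet w Q + (v * w - w * v)) * u 0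
        - u 0 * shiftEquiv.symm (frechet v P - frechet w Q + (v * w - w * v)) := by
    have h₁ : frechet Q P = frechet (shiftEquiv v * u 0 - u 0 * shiftEquiv.symm v) P := by rw [hQ]
    have h₂ : frechet P Q = frechet (shiftEquiv w * u 0 - u 0 * shiftEquiv.symm w) Q := by rw [hP]
    rw [h₁, h₂]
    simp only [frechet_sub, frechet_mul, frechet_u, shift_zero, shiftEquiv_frechet,
      shiftEquiv_symm_frechet, map_add, map_sub, map_mul]
    rw [hP, hQ]
    noncomm_ring
  have hpair : intTr (a * Q) = intTr (w * shiftEquiv v - w * shiftEquiv.symm v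
      + (p - shiftEquiv p) * v) := by
    rw [hQ]; exact isShiftTrace_intTr.pairing ha₁ ha₂ v
  rw [hz, intTr_frechet_congr hpair]
  refine key.trans (congrArg intTr ?_)
  simp only [frechet_sub, frechet_add, frechet_mul, shiftEquiv_frechet, shiftEquiv_symm_frechet]
  noncomm_ring

theorem bracket_jacobi (A B C : Functional) :
    bracket A (bracket B C) + bracket B (bracket C A) + bracket C (bracket A B) = 0 := by
  -- Skewsymmetry moves the inner bracket to the left slot, where its variational derivative acts as
  -- the Fréchet derivative of its density and need not be computed.
  have h (F G K : Functional) : bracket F (bracket G K) =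
      -intTr (frechet (variationalDerivative G * hamiltonianField K) (hamiltonianField F)) := by
    rw [bracket_skew, bracket_apply, variationalDerivative_spec (bracket G K)
      (variationalDerivative G * hamiltonianField K) rfl]
  -- This density makes both terms containing `c_*` comparable, and they cancel by self-adjointness.
  have hskew : intTr (variationalDerivative B * hamiltonianField C) =
      intTr (-(variationalDerivative C * hamiltonianField B)) := by
    rw [map_neg]; exact bracket_skew B C
  have hcomm := intTr_mul_commutator (variationalDerivative_spec A) (variationalDerivative_spec B)
    (hamiltonianField_spec A) (hamiltonianField_spec B) (hamiltonianField_spec C)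
  have hsymm := (variationalDerivative_spec C).frechet_symm (hamiltonianField A)
    (hamiltonianField B)
  rw [h, h, h, intTr_frechet_congr hskew, ← hcomm, frechet_neg, frechet_mul, frechet_mul, mul_sub,
    map_neg, map_add, map_add, map_sub, hsymm]
  abel

theorem isHamiltonian_volterraOperator : IsHamiltonian volterraOperator :=
  ⟨isSkewsymmetric_volterraOperator, bracket, isBracketValue_iff, bracket_skew, bracket_jacobi⟩

theorem isVariationalDerivative_u_zero : IsVariationalDerivative (intTr (u 0)) 1 :=
  isVariationalDerivative_iff.2 fun v => by simp

theorem one_mem_volterraOperator :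
    ((1, u 1 * u 0 - u 0 * u (-1)) : Alg × Alg) ∈ volterraOperator :=
  mem_volterraOperator_iff.2 ⟨u 0, 0, by simp, by simp, by
    simp [shiftEquiv_apply, shiftEquiv_symm_apply]⟩

end NonabelianDifference
end

open NonabelianDifference in
theorem mainTheorem4 :
    -- every local functional has exactly one variational derivative
    (∀ F : Functional, ∃! a : Alg, IsVariationalDerivative F a) ∧
    -- `H` is single-valued, although `(1 - 𝒮)⁻¹` is only defined up to constants
    (∀ a b b' : Alg, (a, b) ∈ volterraOperator → (a, b') ∈ volterraOperator → b = b') ∧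
    -- `H` is defined on all variational derivatives
    (∀ (F : Functional) (a : Alg), IsVariationalDerivative F a →
      ∃ b : Alg, (a, b) ∈ volterraOperator) ∧
    -- `H` is a Hamiltonian operator
    IsHamiltonian volterraOperator ∧
    -- it is the Hamiltonian structure of the Volterra chain, with Hamiltonian `∫ tr u`
    (∀ X : Alg, IsHamiltonianSystem volterraOperator (intTr (u 0)) X ↔
      X = u 1 * u 0 - u 0 * u (-1)) := by
  refine ⟨existsUnique_variationalDerivative, fun a b b' => volterraOperator_unique,
    fun F a => exists_mem_volterraOperator, isHamiltonian_volterraOperator, fun X => ⟨?_, ?_⟩⟩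
  · rintro ⟨-, a, ha, haX⟩
    obtain rfl := ha.unique isVariationalDerivative_u_zero
    exact volterraOperator_unique haX one_mem_volterraOperator
  · rintro rfl
    exact ⟨isHamiltonian_volterraOperator, 1, isVariationalDerivative_u_zero,
      one_mem_volterraOperator⟩
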